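/- All graphs are finite and simple. For a connected graph $G$ let $d_i$ be the degree of vertex $i$ and let $r_G(i,j)=(e_i-e_j)^T L^\dagger (e_i-e_j)$ be the effective resistance, where $L^\dagger$ is the Moore–Penrose pseudoinverse of the Laplacian $L$ of $G$. The moment of a vertex $v$ is $\mu(G,v)=\sum_{i\in V(G)} d_i\, r_G(i,v)$. Kemeny's constant is $\mathscr K(G)=\sum_{j}\pi_j m_{ij}$, where $\pi$ is the stationary distribution of the simple random walk on $G$ and $m_{ij}$ is the mean hitting time of $j$ from $i$ (with $m_{jj}=0$); the sum does not depend on the starting vertex $i$. For a one-vertex graph, $\mathscr K=0$. Let $G_1,G_2$ be connected graphs with $m_1$ and $m_2$ edges and with distinguished vertices $v_1\in V(G_1)$, $v_2\in V(G_2)$. Let $G=G_1\oplus_v G_2$ be their 1-sum, obtained from the disjoint union of $G_1$ and $G_2$ by identifying $v_1$ and $v_2$ to a single vertex $v$, and assume that $G$ has at least one edge. Let $\mathscr L$ be a set of $l\ge 0$ pairs of distinct vertices of $G_2$ that are not edges of $G_2$, and let $\widehat G$ and $\widehat G_2$ be the graphs obtained from $G$ and $G_2$ by adding all pairs in $\mathscr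 L$ as edges. **Theorem.** Let $m=|E(G)|$. Then $m=m_1+m_2$, $|E(\widehat G)|=m+l$, and $$\mathscr K(\widehat G)-\mathscr K(G)=\frac{l\,m_1\bigl(\mu(G_1,v)-\mathscr K(G_1)\bigr)}{m(m+l)}+\frac{A m_1^2+\bigl((A+C)m_2+Bl\bigr)m_1+C\,(m_2^2+l\,m_2)}{m(m+l)},$$ where $A=\mu(\widehat G_2,v)-\mu(G_2,v)$, $B=\mathscr K(\widehat G_2)-\mu(G_2,v)$ and $C=\mathscr K(\widehat G_2)-\mathscr K(G_2)$. -/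

import Mathlib

open Matrix

namespace KemenyGraph

noncomputable section

/-! ### Finite Markov chains: first passage, mean hitting times, Kemeny's constant -/

/-- `firstPassageProb P j t i` is the probability that the Markov chain with transition matrix `P`
started at `i` visits the state `j` for the first time at time `t` (time `0` counts, so a chain
started at `j` has hitting time `0`). -/
def firstPassageProb {V : Type*} [Fintype V] (P : Matrix V V ℝ) (j : V) : ℕ → V → ℝ
  | 0, i => open scoped Classical in if i = j then 1 else 0
  | t + 1, i => open scoped Classical in
      if i = j then 0 else ∑ k, P i k * firstPassageProb P j t k

/-- The mean hitting time `m_{ij}`: the expectation of the first time at which the chain started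
at `i` is in the state `j`. -/
def meanHittingTime {V : Type*} [Fintype V] (P : Matrix V V ℝ) (i j : V) : ℝ :=
  ∑' t : ℕ, (t : ℝ) * firstPassageProb P j t i

/-- `π` is a stationary distribution of the chain with transition matrix `P`. -/
structure IsStationary {V : Type*} [Fintype V] (P : Matrix V V ℝ) (π : V → ℝ) : Prop where
  nonneg : ∀ i, 0 ≤ π i
  sum_eq_one : ∑ i, π i = 1
  invariant : π ᵥ* P = π

/-- The stationary distribution of `P` (meaningful when there is exactly one, as for the random
walk on a connected graph with at least one edge, see `isStationary_walkMatrix_iff`). -/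
def stationaryDistribution {V : Type*} [Fintype V] (P : Matrix V V ℝ) : V → ℝ :=
  Classical.epsilon (IsStationary P)

/-- Kemeny's constant `∑_j π_j m_{ij}` of a Markov chain, computed from the initial state `i`. -/
def chainKemeny {V : Type*} [Fintype V] (P : Matrix V V ℝ) (i : V) : ℝ :=
  ∑ j, stationaryDistribution P j * meanHittingTime P i j

/-! ### Simple graphs -/

/-- The number of edges. -/
def numEdges {V : Type*} (G : SimpleGraph V) : ℕ := G.edgeSet.ncard

/-- The degree of a vertex, as a real number. -/
def deg {V : Type*} [Fintype V] (G : SimpleGraph V) (i : V) : ℝ :=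
  open scoped Classical in (G.degree i : ℝ)

/-- Transition matrix of the simple random walk on `G`: from `i` go to a uniformly chosen
neighbour. -/
def walkMatrix {V : Type*} [Fintype V] (G : SimpleGraph V) : Matrix V V ℝ :=
  open scoped Classical in Matrix.of fun i j => if G.Adj i j then 1 / deg G i else 0

/-- Kemeny's constant of a graph, `𝒦(G) = ∑_j π_j m_{ij}` for the simple random walk on `G`
started at `i`. On a one-vertex graph all hitting times are `0`, so its value is `0`. -/
def kemeny {V : Type*} [Fintype V] (G : SimpleGraph V) (i : V) : ℝ :=
  chainKemeny (walkMatrix G) i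

/-- `X` is a Moore–Penrose pseudoinverse of the real square matrix `A`. -/
structure IsPseudoinverse {V : Type*} [Fintype V] (A X : Matrix V V ℝ) : Prop where
  mul_mul_self : A * X * A = A
  self_mul_mul : X * A * X = X
  symm_mul : (A * X)ᵀ = A * X
  symm_mul' : (X * A)ᵀ = X * A

/-- The Moore–Penrose pseudoinverse `A†`. -/
def pseudoinverse {V : Type*} [Fintype V] (A : Matrix V V ℝ) : Matrix V V ℝ :=
  Classical.epsilon (IsPseudoinverse A)

/-- The graph Laplacian `D - A`. -/
def laplacian {V : Type*} [Fintype V] (G : SimpleGraph V) : Matrix V V ℝ :=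
  open scoped Classical in G.lapMatrix ℝ

/-- Effective resistance `r_G(i,j) = (e_i - e_j)ᵀ L† (e_i - e_j)`. -/
def effectiveResistance {V : Type*} [Fintype V] (G : SimpleGraph V) (i j : V) : ℝ :=
  open scoped Classical in
  (Pi.single i 1 - Pi.single j 1) ⬝ᵥ
    (pseudoinverse (laplacian G) *ᵥ (Pi.single i 1 - Pi.single j 1))

/-- The moment `μ(G,v) = ∑_i d_i r_G(i,v)`. -/
def moment {V : Type*} [Fintype V] (G : SimpleGraph V) (v : V) : ℝ :=
  ∑ i, deg G i * effectiveResistance G i v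

/-- The 1-sum of `G₁` and `G₂` at `v₁`, `v₂`: remove `v₁` from a copy of `G₁`, put `G₂` next to it,
and replace every edge `{i, v₁}` of `G₁` by `{i, v₂}`. -/
def oneSum {V₁ V₂ : Type*} (G₁ : SimpleGraph V₁) (v₁ : V₁) (G₂ : SimpleGraph V₂) (v₂ : V₂) :
    SimpleGraph ({x : V₁ // x ≠ v₁} ⊕ V₂) where
  Adj
    | Sum.inl a, Sum.inl b => G₁.Adj a b
    | Sum.inl a, Sum.inr w => G₁.Adj a v₁ ∧ w = v₂
    | Sum.inr w, Sum.inl a => G₁.Adj a v₁ ∧ w = v₂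
    | Sum.inr w, Sum.inr w' => G₂.Adj w w'
  symm := ⟨by
    rintro (a | w) (b | w') h
    · exact G₁.adj_symm h
    · exact h
    · exact h
    · exact G₂.adj_symm h⟩
  loopless := ⟨by
    rintro (a | w) h
    · exact G₁.irrefl h
    · exact G₂.irrefl h⟩

/-- The graph obtained from `G` by adding the pairs in `L` as edges. -/
def addEdges {V : Type*} (G : SimpleGraph V) (L : Set (Sym2 V)) : SimpleGraph V :=
  G ⊔ SimpleGraph.fromEdgeSet L

/-! ### The chosen objects exist and are unique -/

/-- A matrix has at most one Moore–Penrose pseudoinverse. -/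
theorem IsPseudoinverse.unique {V : Type*} [Fintype V] {A X Y : Matrix V V ℝ}
    (hX : IsPseudoinverse A X) (hY : IsPseudoinverse A Y) : X = Y := by
  have h1 : A * X = A * Y := by
    have e1 : A * Y * (A * X) = A * X := by rw [← Matrix.mul_assoc, hY.mul_mul_self]
    have e2 : A * X * (A * Y) = A * Y := by rw [← Matrix.mul_assoc, hX.mul_mul_self]
    have e3 := congrArg Matrix.transpose e1
    rw [Matrix.transpose_mul, hX.symm_mul, hY.symm_mul, e2] at e3
    exact e3.symm
  have h2 : X * A = Y * A := by
    have e1 : X * A * (Y * A) = X * A := by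
      rw [Matrix.mul_assoc, ← Matrix.mul_assoc A, hY.mul_mul_self]
    have e2 : Y * A * (X * A) = Y * A := by
      rw [Matrix.mul_assoc, ← Matrix.mul_assoc A, hX.mul_mul_self]
    have e3 := congrArg Matrix.transpose e1
    rw [Matrix.transpose_mul, hX.symm_mul', hY.symm_mul', e2] at e3
    exact e3.symm
  calc X = X * A * X := hX.self_mul_mul.symm
    _ = Y * A * X := by rw [h2]
    _ = Y * (A * X) := Matrix.mul_assoc _ _ _
    _ = Y * (A * Y) := by rw [h1]
    _ = Y * A * Y := (Matrix.mul_assoc _ _ _).symm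
    _ = Y := hY.self_mul_mul

/-- A real symmetric matrix has a Moore–Penrose pseudoinverse. -/
theorem exists_isPseudoinverse {V : Type*} [Fintype V] {A : Matrix V V ℝ} (hA : Aᵀ = A) :
    ∃ X, IsPseudoinverse A X := by
  classical
  have hH : A.IsHermitian := by rwa [Matrix.IsHermitian, Matrix.conjTranspose_eq_transpose_of_trivial]
  set U : Matrix V V ℝ := (hH.eigenvectorUnitary : Matrix V V ℝ) with hU
  have hUU : Uᵀ * U = 1 := by
    have := Unitary.coe_star_mul_self hH.eigenvectorUnitary
    rwa [Matrix.star_eq_conjTranspose, Matrix.conjTranspose_eq_transpose_of_trivial] at this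
  set D : V → ℝ := hH.eigenvalues with hD
  have hS : A = U * diagonal D * Uᵀ := by
    have := hH.spectral_theorem
    rw [Unitary.conjStarAlgAut_apply] at this
    rw [Matrix.star_eq_conjTranspose, Matrix.conjTranspose_eq_transpose_of_trivial] at this
    exact this
  have key : ∀ B C : Matrix V V ℝ, U * B * Uᵀ * (U * C * Uᵀ) = U * (B * C) * Uᵀ := by
    intro B C
    calc U * B * Uᵀ * (U * C * Uᵀ) = U * B * (Uᵀ * U) * C * Uᵀ := by
          simp only [Matrix.mul_assoc]
      _ = _ := by rw [hUU]; simp only [Matrix.mul_assoc, Matrix.one_mul]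
  refine ⟨U * diagonal (fun i => (D i)⁻¹) * Uᵀ, ?_, ?_, ?_, ?_⟩
  · rw [hS, key, key, diagonal_mul_diagonal, diagonal_mul_diagonal]
    simp only [mul_inv_mul_cancel]
  · rw [hS, key, key, diagonal_mul_diagonal, diagonal_mul_diagonal]
    congr 3; funext i; by_cases h : D i = 0 <;> simp [h]
  · rw [hS, key, diagonal_mul_diagonal]
    simp [Matrix.transpose_mul, Matrix.mul_assoc]
  · rw [hS, key, diagonal_mul_diagonal]
    simp [Matrix.transpose_mul, Matrix.mul_assoc]

theorem isPseudoinverse_laplacian {V : Type*} [Fintype V] (G : SimpleGraph V) :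
    IsPseudoinverse (laplacian G) (pseudoinverse (laplacian G)) := by
  classical
  exact Classical.epsilon_spec (exists_isPseudoinverse (G.isSymm_lapMatrix (R := ℝ)))

/-- On a connected graph with at least one edge, the simple random walk has exactly one stationary
distribution, namely `π_i = d_i / ∑_k d_k`. -/
theorem isStationary_walkMatrix_iff {V : Type*} [Fintype V] [Nontrivial V] {G : SimpleGraph V}
    (hG : G.Connected) (π : V → ℝ) :
    IsStationary (walkMatrix G) π ↔ π = fun i => deg G i / ∑ k, deg G k := by
  classical
  have hpos : ∀ i, 0 < deg G i := by
    intro i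
    simp only [deg]
    exact_mod_cast hG.preconnected.degree_pos_of_nontrivial i
  have hsum : 0 < ∑ k, deg G k := Finset.sum_pos (fun i _ => hpos i) Finset.univ_nonempty
  have hdeg : ∀ j, ∑ i, (if G.Adj i j then (1 : ℝ) else 0) = deg G j := by
    intro j
    simp only [deg]
    rw [G.degree_eq_sum_if_adj (R := ℝ) j]
    exact Finset.sum_congr rfl fun i _ => by simp only [G.adj_comm]
  have hinv : ∀ π : V → ℝ, π ᵥ* walkMatrix G = π ↔
      ∀ j, ∑ i, (if G.Adj i j then π i / deg G i else 0) = π j := by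
    intro π
    rw [funext_iff]
    refine forall_congr' fun j => ?_
    simp only [vecMul, dotProduct, walkMatrix, Matrix.of_apply, mul_ite, mul_one_div, mul_zero]
  constructor
  · rintro ⟨-, h1, h2⟩
    rw [hinv] at h2
    set y : V → ℝ := fun i => π i / deg G i with hy
    have hL : G.lapMatrix ℝ *ᵥ y = 0 := by
      funext j
      rw [SimpleGraph.lapMatrix_mulVec_apply]
      have h3 := h2 j
      rw [← Finset.sum_filter] at h3
      have h4 : Finset.univ.filter (fun i => G.Adj i j) = G.neighborFinset j := by
        ext i; simp [G.adj_comm]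
      rw [h4] at h3
      rw [h3]
      have := (hpos j).ne'
      simp only [hy, deg] at this ⊢
      rw [mul_div_cancel₀ _ this]
      simp
    rw [SimpleGraph.lapMatrix_mulVec_eq_zero_iff_forall_reachable] at hL
    obtain ⟨i₀⟩ : Nonempty V := inferInstance
    have h5 : ∀ i, π i = y i₀ * deg G i := by
      intro i
      rw [hL i₀ i (hG.preconnected i₀ i), hy]
      exact (div_mul_cancel₀ _ (hpos i).ne').symm
    have h6 : y i₀ * ∑ k, deg G k = 1 := by
      rw [← h1, Finset.mul_sum]
      exact Finset.sum_congr rfl fun i _ => (h5 i).symm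
    funext i
    rw [h5 i, eq_div_iff hsum.ne']
    calc y i₀ * deg G i * ∑ k, deg G k = (y i₀ * ∑ k, deg G k) * deg G i := by ring
      _ = deg G i := by rw [h6, one_mul]
  · rintro rfl
    refine ⟨fun i => div_nonneg (hpos i).le hsum.le, ?_, ?_⟩
    · rw [← Finset.sum_div, div_self hsum.ne']
    · rw [hinv]
      intro j
      rw [← hdeg j, Finset.sum_div]
      refine Finset.sum_congr rfl fun i _ => ?_
      have := (hpos i).ne'
      split_ifs
      · field_simp
      · simp

end

end KemenyGraph

/-! The theorem follows from two facts. The first is that Kemeny's constant is a resistance sum, `4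
m 𝒦(G) = ∑ d_i d_j r(i,j)` (`four_mul_numEdges_mul_kemeny`). To get it, the mean hitting times,
defined as series, are identified with the solution of the first-step equations, and that solution
is written with `L†`.

The second is that in a 1-sum the edges split between the summands, resistances inside a summand are
unchanged, and resistances across the cut vertex add. Sums over ordered adjacent pairs (`adjSum`)
replace degree sums, so the degree of the cut vertex splits by itself. The double sum becomes `m
𝒦(G) = m₁ 𝒦(G₁) + m₂ 𝒦(G₂) + m₂ μ(G₁,v) + m₁ μ(G₂,v)` (`numEdges_mul_kemeny_oneSum`).

Adding edges inside `G₂` commutes with the 1-sum (`addEdges_oneSum`), so this identity also holds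
for `Ĝ`, with `m₂ + l` in place of `m₂`. Subtracting the two is algebra. -/

namespace KemenyGraph

/-! ### Mean hitting times of a finite stochastic matrix -/

section HittingTimes

variable {V : Type*} [Fintype V] {P : Matrix V V ℝ} {j : V}

/-- One step of the chain with transition matrix `P` killed at `j`. -/
noncomputable def killedStep (P : Matrix V V ℝ) (j : V) (w : V → ℝ) : V → ℝ := fun i =>
  open scoped Classical in if i = j then 0 else ∑ k, P i k * w k

theorem killedStep_mono (hP : ∀ i k, 0 ≤ P i k) {w w' : V → ℝ} (h : w ≤ w') :
    killedStep P j w ≤ killedStep P j w' := by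
  intro i
  simp only [killedStep]
  split_ifs
  · exact le_rfl
  · exact Finset.sum_le_sum fun k _ => mul_le_mul_of_nonneg_left (h k) (hP i k)

theorem killedStep_smul (c : ℝ) (w : V → ℝ) :
    killedStep P j (c • w) = c • killedStep P j w := by
  funext i
  simp only [killedStep, Pi.smul_apply, smul_eq_mul]
  split_ifs
  · simp
  · rw [Finset.mul_sum]
    exact Finset.sum_congr rfl fun k _ => by ring

theorem killedStep_sub (w w' : V → ℝ) :
    killedStep P j (w - w') = killedStep P j w - killedStep P j w' := by
  funext i
  simp only [killedStep, Pi.sub_apply]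
  split_ifs
  · simp
  · simp [mul_sub]

theorem killedStep_zero : killedStep P j 0 = 0 := by
  funext i
  simp [killedStep]

theorem firstPassageProb_succ (t : ℕ) :
    firstPassageProb P j (t + 1) = killedStep P j (firstPassageProb P j t) := rfl

/-- A function that vanishes at `j` and solves `h = 1 + P h` elsewhere is nonnegative. -/
theorem nonneg_of_hitting_equation (hP : ∀ i k, 0 ≤ P i k) (hP1 : ∀ i, ∑ k, P i k = 1)
    {h : V → ℝ} (hj : h j = 0) (hh : ∀ i, i ≠ j → h i = 1 + ∑ k, P i k * h k) : 0 ≤ h := by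
  have : Nonempty V := ⟨j⟩
  obtain ⟨i₀, hi₀⟩ := Finite.exists_min h
  have h0 : i₀ = j := by
    -- Minimum principle: at a minimum other than `j` the equation would give `h i₀ ≥ 1 + h i₀`.
    by_contra hne
    have h1 : ∑ k, P i₀ k * h i₀ ≤ ∑ k, P i₀ k * h k :=
      Finset.sum_le_sum fun k _ => mul_le_mul_of_nonneg_left (hi₀ k) (hP i₀ k)
    rw [← Finset.sum_mul, hP1, one_mul] at h1
    linarith [hh i₀ hne]
  intro i
  rw [Pi.zero_apply, ← hj, ← h0]
  exact hi₀ i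

/-- The mean hitting time of `j` is the solution of the first-step equations. -/
theorem meanHittingTime_eq_of_hitting_equation (hP : ∀ i k, 0 ≤ P i k)
    (hP1 : ∀ i, ∑ k, P i k = 1) {h : V → ℝ} (hj : h j = 0)
    (hh : ∀ i, i ≠ j → h i = 1 + ∑ k, P i k * h k) (i : V) :
    meanHittingTime P i j = h i := by
  classical
  have hnn := nonneg_of_hitting_equation hP hP1 hj hh
  set K := killedStep P j with hK
  -- `(K^[t] e) i` is the tail probability that the hitting time of `j` from `i` exceeds `t`.
  set e : V → ℝ := fun i => if i = j then 0 else 1 with he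
  have hmono : Monotone K := fun _ _ => killedStep_mono hP
  have hKh : K h = h - e := by
    funext i
    simp only [hK, he, killedStep, Pi.sub_apply]
    split_ifs with hij
    · rw [hij, hj]; simp
    · rw [hh i hij]; ring
  have heh : e ≤ h := by
    intro i
    simp only [he]
    split_ifs with hij
    · exact hnn i
    · rw [hh i hij, le_add_iff_nonneg_right]
      exact Finset.sum_nonneg fun k _ => mul_nonneg (hP i k) (hnn k)
  have hf1 : firstPassageProb P j 1 = e - K e := by
    funext i
    simp only [firstPassageProb, he, hK, killedStep, Pi.sub_apply]
    split_ifs with hij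
    · simp
    · rw [eq_sub_iff_add_eq, ← Finset.sum_add_distrib]
      refine (Finset.sum_congr rfl fun k _ => ?_).trans (hP1 i)
      split_ifs <;> ring
  have hiter_sub : ∀ (t : ℕ) (w w' : V → ℝ), K^[t] (w - w') = K^[t] w - K^[t] w' := by
    intro t
    induction t with
    | zero => intro w w'; rfl
    | succ t ih =>
      intro w w'
      rw [Function.iterate_succ_apply, hK, killedStep_sub, ← hK, ih]
      rfl
  have hiter_zero : ∀ t : ℕ, K^[t] 0 = 0 := by
    intro t
    induction t with
    | zero => rfl
    | succ t ih => rw [Function.iterate_succ_apply, hK, killedStep_zero, ← hK, ih]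
  have hf : ∀ t, firstPassageProb P j (t + 1) = K^[t] e - K^[t + 1] e := by
    intro t
    induction t with
    | zero => exact hf1
    | succ t ih =>
      rw [firstPassageProb_succ, ih, killedStep_sub, ← hK, ← Function.iterate_succ_apply' K,
        ← Function.iterate_succ_apply' K]
  have hiter_nonneg : ∀ (t : ℕ) {w : V → ℝ}, 0 ≤ w → 0 ≤ K^[t] w := by
    intro t w hw
    have := hmono.iterate t hw
    rwa [hiter_zero] at this
  have hfnn : ∀ t, 0 ≤ firstPassageProb P j t := by
    intro t
    induction t with
    | zero =>
      intro i
      simp only [firstPassageProb, Pi.zero_apply]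
      split_ifs <;> norm_num
    | succ t ih =>
      rw [firstPassageProb_succ]
      have := killedStep_mono (j := j) hP ih
      rwa [killedStep_zero] at this
  -- geometric decay of the killed chain
  obtain ⟨ρ, hρ0, hρ1, hρ⟩ : ∃ ρ : ℝ, 0 ≤ ρ ∧ ρ < 1 ∧ K h ≤ ρ • h := by
    set H : ℝ := 1 + ∑ k, h k with hH
    have hsum : 0 ≤ ∑ k, h k := Finset.sum_nonneg fun k _ => hnn k
    have hH1 : 1 ≤ H := by linarith
    have hle : ∀ k, h k ≤ H := fun k => by
      have := Finset.single_le_sum (f := h) (fun k _ => hnn k) (Finset.mem_univ k)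
      linarith
    -- Off `j`, `K h = h - 1`, and `h ≤ H` gives `1 ≥ h / H`. The summand `1` in `H` ensures `H ≥
    -- 1`, hence `ρ ≥ 0`.
    refine ⟨1 - 1 / H, ?_, ?_, ?_⟩
    · rw [sub_nonneg, div_le_one (by linarith)]; exact hH1
    · have : 0 < 1 / H := by positivity
      linarith
    · intro i
      rw [hKh]
      simp only [Pi.sub_apply, Pi.smul_apply, smul_eq_mul, he]
      split_ifs with hij
      · rw [hij, hj]; simp
      · have : 1 / H * h i ≤ 1 := by
          rw [div_mul_eq_mul_div, one_mul, div_le_one (by linarith)]; exact hle i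
        linarith
  have hdecay : ∀ t, K^[t] h ≤ ρ ^ t • h := by
    intro t
    induction t with
    | zero => simp
    | succ t ih =>
      rw [Function.iterate_succ_apply']
      refine (hmono ih).trans ?_
      rw [hK, killedStep_smul, ← hK, pow_succ, mul_smul]
      exact smul_le_smul_of_nonneg_left hρ (pow_nonneg hρ0 t)
  -- Iterating `K h = h - e` makes the tail sum telescope.
  have htel : ∀ N, ∑ t ∈ Finset.range N, (K^[t] e) i = h i - (K^[N] h) i := by
    intro N
    induction N with
    | zero => simp
    | succ N ih =>
      have : K^[N + 1] h = K^[N] h - K^[N] e := by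
        rw [Function.iterate_succ_apply, hKh, hiter_sub]
      rw [Finset.sum_range_succ, ih, this, Pi.sub_apply]
      ring
  -- Summation by parts: the expectation becomes a sum of tails, with boundary term `N` times the
  -- tail at `N`.
  have hpart : ∀ N : ℕ, ∑ t ∈ Finset.range (N + 1), (t : ℝ) * firstPassageProb P j t i
      = h i - (K^[N] h) i - N * (K^[N] e) i := by
    intro N
    rw [← htel]
    induction N with
    | zero => simp
    | succ N ih =>
      rw [Finset.sum_range_succ, ih, hf, Finset.sum_range_succ, Pi.sub_apply]
      push_cast
      ring
  have hlim1 : Filter.Tendsto (fun N => (K^[N] h) i) Filter.atTop (nhds 0) := by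
    have h0 : Filter.Tendsto (fun N : ℕ => ρ ^ N * h i) Filter.atTop (nhds 0) := by
      simpa using (tendsto_pow_atTop_nhds_zero_of_lt_one hρ0 hρ1).mul_const (h i)
    exact squeeze_zero (fun N => hiter_nonneg N hnn i) (fun N => hdecay N i) h0
  have hlim2 : Filter.Tendsto (fun N : ℕ => (N : ℝ) * (K^[N] e) i) Filter.atTop (nhds 0) := by
    have h0 : Filter.Tendsto (fun N : ℕ => (N : ℝ) * ρ ^ N * h i) Filter.atTop (nhds 0) := by
      simpa using (tendsto_self_mul_const_pow_of_lt_one hρ0 hρ1).mul_const (h i)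
    have he0 : 0 ≤ e := by
      intro i
      simp only [he, Pi.zero_apply]
      split_ifs <;> norm_num
    refine squeeze_zero (fun N => mul_nonneg N.cast_nonneg (hiter_nonneg N he0 i))
      (fun N => ?_) h0
    -- Since `e ≤ h`, the tails inherit the geometric decay of `K^[N] h`, which beats the factor
    -- `N`.
    rw [mul_assoc]
    exact mul_le_mul_of_nonneg_left ((hmono.iterate N heh i).trans (hdecay N i)) N.cast_nonneg
  refine HasSum.tsum_eq ?_
  rw [hasSum_iff_tendsto_nat_of_nonneg (fun t => mul_nonneg t.cast_nonneg (hfnn t i)),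
    ← Filter.tendsto_add_atTop_iff_nat 1]
  simp only [hpart]
  simpa using (tendsto_const_nhds (x := h i)).sub hlim1 |>.sub hlim2

end HittingTimes

/-! ### Sums over ordered pairs of adjacent vertices -/

section AdjSum

variable {V : Type*} [Fintype V]

/-- The sum of `F` over all ordered pairs of adjacent vertices. -/
noncomputable def adjSum (G : SimpleGraph V) (F : V → V → ℝ) : ℝ :=
  open scoped Classical in ∑ x, ∑ y, if G.Adj x y then F x y else 0

theorem sum_adj_eq_deg (G : SimpleGraph V) (x : V) :
    (open scoped Classical in ∑ y, if G.Adj x y then (1 : ℝ) else 0) = deg G x := by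
  classical
  simp only [deg]
  rw [G.degree_eq_sum_if_adj (R := ℝ) x]

theorem sum_deg_mul (G : SimpleGraph V) (g : V → ℝ) :
    ∑ x, deg G x * g x = adjSum G fun x _ => g x := by
  classical
  simp only [adjSum]
  refine Finset.sum_congr rfl fun x _ => ?_
  rw [← sum_adj_eq_deg, Finset.sum_mul]
  exact Finset.sum_congr rfl fun y _ => by split_ifs <;> simp

theorem sum_deg (G : SimpleGraph V) : ∑ x, deg G x = 2 * numEdges G := by
  classical
  have h := G.sum_degrees_eq_twice_card_edges
  simp only [deg, numEdges]
  rw [← SimpleGraph.coe_edgeFinset, Set.ncard_coe_finset]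
  exact_mod_cast h

theorem adjSum_const (G : SimpleGraph V) (c : ℝ) :
    (adjSum G fun _ _ => c) = 2 * numEdges G * c := by
  rw [← sum_deg_mul, ← Finset.sum_mul, sum_deg]

theorem adjSum_add (G : SimpleGraph V) (F F' : V → V → ℝ) :
    (adjSum G fun x y => F x y + F' x y) = adjSum G F + adjSum G F' := by
  classical
  simp only [adjSum, ← Finset.sum_add_distrib]
  refine Finset.sum_congr rfl fun x _ => Finset.sum_congr rfl fun y _ => ?_
  split_ifs <;> simp

theorem adjSum_const_mul (G : SimpleGraph V) (c : ℝ) (F : V → V → ℝ) :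
    (adjSum G fun x y => c * F x y) = c * adjSum G F := by
  classical
  simp only [adjSum, Finset.mul_sum]
  refine Finset.sum_congr rfl fun x _ => Finset.sum_congr rfl fun y _ => ?_
  split_ifs <;> simp

theorem laplacian_mulVec_apply (G : SimpleGraph V) (φ : V → ℝ) (x : V) :
    (laplacian G *ᵥ φ) x =
      deg G x * φ x - open scoped Classical in ∑ y, if G.Adj x y then φ y else 0 := by
  classical
  simp only [laplacian, deg]
  rw [SimpleGraph.lapMatrix_mulVec_apply, ← Finset.sum_filter]
  congr 2
  ext y
  simp

/-- The Dirichlet form of a graph. -/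
theorem adjSum_sub_mul_sub (G : SimpleGraph V) (φ ψ : V → ℝ) :
    (adjSum G fun x y => (φ x - φ y) * (ψ x - ψ y)) = 2 * (ψ ⬝ᵥ laplacian G *ᵥ φ) := by
  classical
  have h1 : (adjSum G fun x y => (φ x - φ y) * ψ x) = ψ ⬝ᵥ laplacian G *ᵥ φ := by
    simp only [adjSum, dotProduct, laplacian_mulVec_apply]
    refine Finset.sum_congr rfl fun x _ => ?_
    rw [← sum_adj_eq_deg, Finset.sum_mul, ← Finset.sum_sub_distrib, Finset.mul_sum]
    refine Finset.sum_congr rfl fun y _ => ?_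
    split_ifs <;> ring
  -- Swapping `x` and `y` turns this half of the form into the previous one.
  have h2 : (adjSum G fun x y => (φ y - φ x) * ψ y) = ψ ⬝ᵥ laplacian G *ᵥ φ := by
    rw [← h1]
    simp only [adjSum]
    rw [Finset.sum_comm]
    refine Finset.sum_congr rfl fun x _ => Finset.sum_congr rfl fun y _ => ?_
    simp only [G.adj_comm]
  calc _ = adjSum G fun x y => (φ x - φ y) * ψ x + (φ y - φ x) * ψ y := by
        congr 1; funext x y; ring
    _ = _ := by rw [adjSum_add, h1, h2]; ring

end AdjSum

/-! ### Effective resistance -/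

section Resistance

variable {V : Type*} [Fintype V]

theorem transpose_laplacian (G : SimpleGraph V) : (laplacian G)ᵀ = laplacian G := by
  classical
  exact G.isSymm_lapMatrix (R := ℝ)

/-- Transposing the Penrose equations of a symmetric matrix permutes them, so uniqueness applies. -/
theorem transpose_pseudoinverse_laplacian (G : SimpleGraph V) :
    (pseudoinverse (laplacian G))ᵀ = pseudoinverse (laplacian G) := by
  have h := isPseudoinverse_laplacian G
  have hL := transpose_laplacian G
  refine IsPseudoinverse.unique (A := laplacian G) ⟨?_, ?_, ?_, ?_⟩ h
  · simpa [Matrix.transpose_mul, hL, Matrix.mul_assoc] using congrArg transpose h.mul_mul_self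
  · simpa [Matrix.transpose_mul, hL, Matrix.mul_assoc] using congrArg transpose h.self_mul_mul
  · have := h.symm_mul'
    rw [Matrix.transpose_mul, hL] at this
    rw [this, Matrix.transpose_mul, hL, this]
  · have := h.symm_mul
    rw [Matrix.transpose_mul, hL] at this
    rw [this, Matrix.transpose_mul, hL, this]

theorem effectiveResistance_eq (G : SimpleGraph V) (i j : V) :
    effectiveResistance G i j = pseudoinverse (laplacian G) i i + pseudoinverse (laplacian G) j j
      - 2 * pseudoinverse (laplacian G) i j := by
  have h : pseudoinverse (laplacian G) j i = pseudoinverse (laplacian G) i j :=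
    congrFun (congrFun (transpose_pseudoinverse_laplacian G) i) j
  simp only [effectiveResistance, Matrix.mulVec_sub, sub_dotProduct, dotProduct_sub,
    single_dotProduct, Matrix.mulVec_single_one, Matrix.col_apply, one_mul, h]
  ring

theorem effectiveResistance_comm (G : SimpleGraph V) (i j : V) :
    effectiveResistance G i j = effectiveResistance G j i := by
  have h : pseudoinverse (laplacian G) j i = pseudoinverse (laplacian G) i j :=
    congrFun (congrFun (transpose_pseudoinverse_laplacian G) i) j
  rw [effectiveResistance_eq, effectiveResistance_eq, h]
  ring

/-- On a connected graph the Laplacian inverts its pseudoinverse on vectors with sum zero. -/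
theorem laplacian_mulVec_pseudoinverse_mulVec {G : SimpleGraph V} (hG : G.Connected)
    {b : V → ℝ} (hb : ∑ i, b i = 0) :
    laplacian G *ᵥ (pseudoinverse (laplacian G) *ᵥ b) = b := by
  classical
  set L := laplacian G with hL
  set X := pseudoinverse L
  have h : IsPseudoinverse L X := isPseudoinverse_laplacian G
  have hLt : Lᵀ = L := transpose_laplacian G
  have hXt : Xᵀ = X := transpose_pseudoinverse_laplacian G
  have hcomm : L * X = X * L := by
    have := h.symm_mul
    rw [Matrix.transpose_mul, hLt, hXt] at this
    exact this.symm
  -- The defect `b - L L† b` lies in the kernel of `L`, because `L L L† = L L† L = L`. By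
  -- connectedness it is constant, and its entries sum to zero, so it vanishes.
  have hy : L *ᵥ (b - L *ᵥ (X *ᵥ b)) = 0 := by
    rw [Matrix.mulVec_sub, Matrix.mulVec_mulVec, Matrix.mulVec_mulVec, Matrix.mul_assoc, hcomm,
      ← Matrix.mul_assoc, h.mul_mul_self, sub_self]
  have hsumL : ∀ w : V → ℝ, ∑ i, (L *ᵥ w) i = 0 := by
    intro w
    have h1 := adjSum_sub_mul_sub G w (fun _ => (1 : ℝ))
    simp only [sub_self, mul_zero, adjSum_const, dotProduct, one_mul] at h1
    linarith
  obtain ⟨i₀⟩ := hG.nonempty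
  set y := b - L *ᵥ (X *ᵥ b) with hydef
  have hconst : ∀ i, y i = y i₀ := by
    have h2 := hy
    rw [hL, laplacian, SimpleGraph.lapMatrix_mulVec_eq_zero_iff_forall_reachable] at h2
    exact fun i => h2 i i₀ (hG.preconnected i i₀)
  have hsum : ∑ i, y i = 0 := by
    simp only [hydef, Pi.sub_apply, Finset.sum_sub_distrib, hb, hsumL, sub_zero]
  have hy0 : y i₀ = 0 := by
    rw [Finset.sum_congr rfl fun i _ => hconst i, Finset.sum_const, nsmul_eq_mul,
      mul_eq_zero] at hsum
    rcases hsum with h3 | h3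
    · have : Nonempty V := ⟨i₀⟩
      exact absurd h3 (by simp [Finset.card_univ])
    · exact h3
  funext i
  have h4 := (hconst i).trans hy0
  rw [hydef, Pi.sub_apply] at h4
  linarith

/-- The effective resistance is the potential difference of a unit flow. -/
theorem effectiveResistance_eq_sub (G : SimpleGraph V) {i j : V} {φ : V → ℝ}
    (hφ : ∀ ψ : V → ℝ,
      (adjSum G fun x y => (φ x - φ y) * (ψ x - ψ y)) = 2 * (ψ i - ψ j)) :
    effectiveResistance G i j = φ i - φ j := by
  classical
  have hψ : ∀ ψ : V → ℝ, ψ ⬝ᵥ laplacian G *ᵥ φ = ψ i - ψ j := by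
    intro ψ
    have h := hφ ψ
    rw [adjSum_sub_mul_sub] at h
    linarith
  have h1 : laplacian G *ᵥ φ = Pi.single i 1 - Pi.single j 1 := by
    funext k
    have := hψ (Pi.single k 1)
    rw [single_dotProduct, one_mul] at this
    rw [this, Pi.sub_apply, Pi.single_comm, Pi.single_comm k,
      Pi.single_apply, Pi.single_apply]
  -- With `e_i - e_j = L φ`, the resistance is `φᵀ L L† L φ = φᵀ L φ`.
  have h2 : effectiveResistance G i j =
      (laplacian G *ᵥ φ) ⬝ᵥ (pseudoinverse (laplacian G) *ᵥ (laplacian G *ᵥ φ)) := by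
    rw [h1]
    simp only [effectiveResistance]
  have h3 : laplacian G *ᵥ φ = φ ᵥ* laplacian G := by
    conv_rhs => rw [← transpose_laplacian G, Matrix.vecMul_transpose]
  rw [h2]
  conv_lhs => rw [h3, ← Matrix.dotProduct_mulVec, ← h3, Matrix.mulVec_mulVec, Matrix.mulVec_mulVec,
    (isPseudoinverse_laplacian G).mul_mul_self]
  exact hψ φ

/-- The potential is `L† (e_i - e_j)`. The weak form, tested against every `ψ`, is what can be glued
along a 1-sum. -/
theorem exists_potential {G : SimpleGraph V} (hG : G.Connected) (i j : V) :
    ∃ φ : V → ℝ, (∀ ψ : V → ℝ,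
      (adjSum G fun x y => (φ x - φ y) * (ψ x - ψ y)) = 2 * (ψ i - ψ j)) ∧
      effectiveResistance G i j = φ i - φ j := by
  classical
  set b : V → ℝ := Pi.single i 1 - Pi.single j 1 with hb
  have h0 : ∑ k, b k = 0 := by simp [hb, Finset.sum_sub_distrib]
  have h : ∀ ψ : V → ℝ, (adjSum G fun x y =>
      ((pseudoinverse (laplacian G) *ᵥ b) x - (pseudoinverse (laplacian G) *ᵥ b) y)
        * (ψ x - ψ y)) = 2 * (ψ i - ψ j) := by
    intro ψ
    rw [adjSum_sub_mul_sub, laplacian_mulVec_pseudoinverse_mulVec hG h0, hb, dotProduct_sub,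
      dotProduct_single, dotProduct_single, mul_one, mul_one]
  exact ⟨_, h, effectiveResistance_eq_sub G h⟩

end Resistance

/-! ### Kemeny's constant in terms of effective resistances -/

section Kemeny

variable {V : Type*} [Fintype V]

/-- Multiplied by the degree, the first-step equation off `j` reads `(L g) i = d_i`. Hitting times
are thus potential differences for a current entering at each vertex in proportion to its degree and
leaving at `j`. -/
theorem meanHittingTime_walkMatrix [Nontrivial V] {G : SimpleGraph V} (hG : G.Connected)
    (i j : V) :
    meanHittingTime (walkMatrix G) i j = (∑ k, deg G k * (effectiveResistance G i j
      + effectiveResistance G j k - effectiveResistance G i k)) / 2 := by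
  classical
  set X := pseudoinverse (laplacian G) with hX
  set D := ∑ k, deg G k with hD
  have hpos : ∀ i, 0 < deg G i := by
    intro i
    simp only [deg]
    exact_mod_cast hG.preconnected.degree_pos_of_nontrivial i
  -- The entry at `j` is lowered by the total degree, so that `b` sums to zero and `L g = b` is
  -- solvable.
  set b : V → ℝ := deg G - D • Pi.single j 1 with hb
  have hb0 : ∑ k, b k = 0 := by
    simp [hb, Finset.sum_sub_distrib, ← Finset.mul_sum, hD]
  set g := X *ᵥ b with hg
  have hLg : laplacian G *ᵥ g = b := laplacian_mulVec_pseudoinverse_mulVec hG hb0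
  have hP : ∀ i k, 0 ≤ walkMatrix G i k := by
    intro i k
    simp only [walkMatrix, Matrix.of_apply]
    split_ifs
    · exact (one_div_pos.2 (hpos i)).le
    · exact le_rfl
  have hmul : ∀ (w : V → ℝ) i, ∑ k, walkMatrix G i k * w k
      = (∑ k, if G.Adj i k then w k else 0) / deg G i := by
    intro w i
    rw [Finset.sum_div]
    refine Finset.sum_congr rfl fun k _ => ?_
    simp only [walkMatrix, Matrix.of_apply]
    split_ifs <;> ring
  have hP1 : ∀ i, ∑ k, walkMatrix G i k = 1 := by
    intro i
    have := hmul (fun _ => 1) i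
    simp only [mul_one] at this
    rw [this, div_eq_one_iff_eq (hpos i).ne']
    convert sum_adj_eq_deg G i
  have hsol : meanHittingTime (walkMatrix G) i j = g i - g j := by
    refine meanHittingTime_eq_of_hitting_equation (h := fun i => g i - g j) hP hP1
      (sub_self _) (fun i hij => ?_) i
    have h1 := congrFun hLg i
    rw [laplacian_mulVec_apply, hb, Pi.sub_apply, Pi.smul_apply, Pi.single_eq_of_ne hij,
      smul_zero, sub_zero] at h1
    have h2 : ∑ k, walkMatrix G i k * (g k - g j) = ∑ k, walkMatrix G i k * g k - g j := by
      simp only [mul_sub, Finset.sum_sub_distrib, ← Finset.sum_mul, hP1, one_mul]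
    have h3 : (∑ k, if G.Adj i k then g k else 0) = deg G i * g i - deg G i := by
      linarith
    have h4 := (hpos i).ne'
    rw [h2, hmul, h3]
    field_simp
    ring
  have hgi : ∀ i, g i = ∑ k, deg G k * (X i k - X i j) := by
    intro i
    simp only [hg, hb, Matrix.mulVec_sub, Matrix.mulVec_smul, Matrix.mulVec_single_one,
      Pi.sub_apply, Pi.smul_apply, smul_eq_mul, Matrix.col_apply, hD, mul_sub,
      Finset.sum_sub_distrib, Finset.sum_mul, Matrix.mulVec, dotProduct]
    simp only [mul_comm]
  rw [hsol, hgi, hgi, ← Finset.sum_sub_distrib, Finset.sum_div]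
  refine Finset.sum_congr rfl fun k _ => ?_
  simp only [effectiveResistance_eq, ← hX]
  ring

/-- `4 m 𝒦(G) = ∑_{i,j} d_i d_j r(i,j)`. -/
theorem four_mul_numEdges_mul_kemeny {G : SimpleGraph V} (hG : G.Connected) (s : V) :
    4 * (numEdges G * kemeny G s) =
      adjSum G fun x _ => adjSum G fun y _ => effectiveResistance G x y := by
  classical
  rcases subsingleton_or_nontrivial V with hV | hV
  · have h : ∀ F : V → V → ℝ, adjSum G F = 0 := by
      intro F
      simp only [adjSum]
      refine Finset.sum_eq_zero fun x _ => Finset.sum_eq_zero fun y _ => ?_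
      rw [if_neg]
      rw [Subsingleton.elim x y]
      exact G.irrefl
    have h1 := adjSum_const G 1
    rw [h] at h1
    have h2 : (numEdges G : ℝ) = 0 := by linarith
    rw [h, h2]
    ring
  · have hst : stationaryDistribution (walkMatrix G) = fun i => deg G i / ∑ k, deg G k :=
      (isStationary_walkMatrix_iff hG _).1 (Classical.epsilon_spec
        ⟨_, (isStationary_walkMatrix_iff hG _).2 rfl⟩)
    have hD : 0 < ∑ k, deg G k := by
      refine Finset.sum_pos (fun i _ => ?_) Finset.univ_nonempty
      simp only [deg]
      exact_mod_cast hG.preconnected.degree_pos_of_nontrivial i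
    have hm := sum_deg G
    have hm0 : (numEdges G : ℝ) ≠ 0 := by
      intro h
      rw [h] at hm
      linarith
    simp only [kemeny, chainKemeny, hst, meanHittingTime_walkMatrix hG, ← sum_deg_mul]
    set r := effectiveResistance G
    set S := ∑ k, deg G k * r s k with hS
    have key : ∀ j, ∑ k, deg G k * (r s j + r j k - r s k)
        = 2 * numEdges G * r s j + ∑ k, deg G k * r j k - S := by
      intro j
      rw [← hm, hS, Finset.sum_mul, ← Finset.sum_add_distrib, ← Finset.sum_sub_distrib]
      exact Finset.sum_congr rfl fun k _ => by ring
    -- Averaging over `j` removes the starting vertex: `∑ d_j = 2m` makes the `r(s,j)` terms cancel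
    -- against `S`.
    have key2 : ∑ j, deg G j * (2 * numEdges G * r s j + ∑ k, deg G k * r j k - S)
        = ∑ j, deg G j * ∑ k, deg G k * r j k := by
      have : ∀ j, deg G j * (2 * numEdges G * r s j + ∑ k, deg G k * r j k - S)
          = 2 * numEdges G * (deg G j * r s j) + deg G j * (∑ k, deg G k * r j k)
            - deg G j * S := by
        intro j; ring
      simp only [this, Finset.sum_sub_distrib, Finset.sum_add_distrib, ← Finset.mul_sum,
        ← Finset.sum_mul, hm]
      ring
    rw [← key2, Finset.mul_sum, Finset.mul_sum]
    refine Finset.sum_congr rfl fun j _ => ?_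
    rw [key, hm]
    field_simp
    ring

end Kemeny

/-! ### The 1-sum -/

section OneSumLeft

variable {V₁ V₂ : Type*} [DecidableEq V₁] {v₁ : V₁} {v₂ : V₂}

/-- The inclusion of the first summand in the vertex set of a 1-sum. -/
def oneSumLeft (v₁ : V₁) (v₂ : V₂) (x : V₁) : {x : V₁ // x ≠ v₁} ⊕ V₂ :=
  if h : x = v₁ then Sum.inr v₂ else Sum.inl ⟨x, h⟩

theorem oneSumLeft_self : oneSumLeft v₁ v₂ v₁ = Sum.inr v₂ := dif_pos rfl

theorem oneSumLeft_coe (a : {x : V₁ // x ≠ v₁}) : oneSumLeft v₁ v₂ a = Sum.inl a :=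
  dif_neg a.2

theorem oneSum_adj_oneSumLeft {G₁ : SimpleGraph V₁} {G₂ : SimpleGraph V₂} {x y : V₁}
    (h : G₁.Adj x y) :
    (oneSum G₁ v₁ G₂ v₂).Adj (oneSumLeft v₁ v₂ x) (oneSumLeft v₁ v₂ y) := by
  by_cases hx : x = v₁
  · have hy : y ≠ v₁ := fun hy => h.ne (hx.trans hy.symm)
    subst hx
    rw [oneSumLeft_self, oneSumLeft_coe ⟨y, hy⟩]
    exact ⟨h.symm, rfl⟩
  · by_cases hy : y = v₁
    · subst hy
      rw [oneSumLeft_self, oneSumLeft_coe ⟨x, hx⟩]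
      exact ⟨h, rfl⟩
    · rw [oneSumLeft_coe ⟨x, hx⟩, oneSumLeft_coe ⟨y, hy⟩]
      exact h

theorem oneSum_connected {G₁ : SimpleGraph V₁} {G₂ : SimpleGraph V₂} (h₁ : G₁.Connected)
    (h₂ : G₂.Connected) : (oneSum G₁ v₁ G₂ v₂).Connected := by
  let f₁ : G₁ →g oneSum G₁ v₁ G₂ v₂ := ⟨oneSumLeft v₁ v₂, oneSum_adj_oneSumLeft⟩
  let f₂ : G₂ →g oneSum G₁ v₁ G₂ v₂ := ⟨Sum.inr, fun h => h⟩
  have key : ∀ x, (oneSum G₁ v₁ G₂ v₂).Reachable x (Sum.inr v₂) := by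
    rintro (a | w)
    · have h : (oneSum G₁ v₁ G₂ v₂).Reachable (oneSumLeft v₁ v₂ a) (oneSumLeft v₁ v₂ v₁) :=
        (h₁.preconnected a v₁).map f₁
      rwa [oneSumLeft_coe, oneSumLeft_self] at h
    · exact (h₂.preconnected w v₂).map f₂
  exact { preconnected := fun x y => (key x).trans (key y).symm, nonempty := ⟨Sum.inr v₂⟩ }

/-- Extension of a function on the first summand, constant on the second one. -/
theorem exists_extend_left (v₂ : V₂) (φ : V₁ → ℝ) :
    ∃ Φ : {x : V₁ // x ≠ v₁} ⊕ V₂ → ℝ, (∀ x, Φ (oneSumLeft v₁ v₂ x) = φ x) ∧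
      ∀ w, Φ (Sum.inr w) = φ v₁ := by
  refine ⟨Sum.elim (fun a => φ a) fun _ => φ v₁, fun x => ?_, fun w => rfl⟩
  by_cases hx : x = v₁
  · rw [hx, oneSumLeft_self, Sum.elim_inr]
  · rw [oneSumLeft_coe ⟨x, hx⟩, Sum.elim_inl]

/-- Extension of a function on the second summand, constant on the first one. -/
theorem exists_extend_right (v₁ : V₁) (v₂ : V₂) (φ : V₂ → ℝ) :
    ∃ Φ : {x : V₁ // x ≠ v₁} ⊕ V₂ → ℝ, (∀ x, Φ (oneSumLeft v₁ v₂ x) = φ v₂) ∧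
      ∀ w, Φ (Sum.inr w) = φ w := by
  refine ⟨Sum.elim (fun _ => φ v₂) φ, fun x => ?_, fun w => rfl⟩
  by_cases hx : x = v₁
  · rw [hx, oneSumLeft_self, Sum.elim_inr]
  · rw [oneSumLeft_coe ⟨x, hx⟩, Sum.elim_inl]

end OneSumLeft

/-! ### Adding edges -/

/-- Adding edges to the second summand commutes with the 1-sum. -/
theorem addEdges_oneSum {V₁ V₂ : Type*} {v₁ : V₁} {v₂ : V₂} (G₁ : SimpleGraph V₁) (G₂ : SimpleGraph V₂)
    (L : Set (Sym2 V₂)) :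
    addEdges (oneSum G₁ v₁ G₂ v₂) (Sym2.map Sum.inr '' L) = oneSum G₁ v₁ (addEdges G₂ L) v₂ := by
  have hl : ∀ (a : {x : V₁ // x ≠ v₁}) (y : {x : V₁ // x ≠ v₁} ⊕ V₂),
      s(Sum.inl a, y) ∉ Sym2.map (Sum.inr : V₂ → {x : V₁ // x ≠ v₁} ⊕ V₂) '' L := by
    rintro a y ⟨e, -, he⟩
    have h : Sum.inl a ∈ Sym2.map (Sum.inr : V₂ → {x : V₁ // x ≠ v₁} ⊕ V₂) e := by
      rw [he]; exact Sym2.mem_mk_left _ _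
    obtain ⟨w, -, hw⟩ := Sym2.mem_map.1 h
    cases hw
  have hr : ∀ w w' : V₂, s(Sum.inr w, Sum.inr w')
      ∈ Sym2.map (Sum.inr : V₂ → {x : V₁ // x ≠ v₁} ⊕ V₂) '' L ↔ s(w, w') ∈ L := by
    intro w w'
    rw [← Sym2.map_mk, (Sym2.map.injective Sum.inr_injective).mem_set_image]
  ext x y
  simp only [addEdges, SimpleGraph.sup_adj, SimpleGraph.fromEdgeSet_adj]
  rcases x with a | w <;> rcases y with b | w'
  · simp [hl, oneSum]
  · simp [hl, oneSum]
  · rw [Sym2.eq_swap]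
    simp [hl, oneSum]
  · simp [hr, oneSum]

theorem addEdges_connected {V : Type*} {G : SimpleGraph V} (hG : G.Connected) (L : Set (Sym2 V)) :
    (addEdges G L).Connected :=
  hG.mono le_sup_left

theorem numEdges_addEdges {V : Type*} [Finite V] (G : SimpleGraph V) (L : Finset (Sym2 V))
    (hL : ∀ e ∈ L, ¬ e.IsDiag ∧ e ∉ G.edgeSet) :
    numEdges (addEdges G (L : Set (Sym2 V))) = numEdges G + L.card := by
  have h : (addEdges G (L : Set (Sym2 V))).edgeSet = G.edgeSet ∪ L := by
    rw [addEdges, SimpleGraph.edgeSet_sup, SimpleGraph.edgeSet_fromEdgeSet]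
    congr 1
    exact sdiff_eq_left.2 (Set.disjoint_left.2 fun e he hd => (hL e he).1 (by simpa using hd))
  rw [numEdges, h, Set.ncard_union_eq (Set.disjoint_right.2 fun e he => (hL e he).2)
    (Set.toFinite _) (Set.toFinite _), Set.ncard_coe_finset, numEdges]

section OneSum

variable {V₁ V₂ : Type*} [Fintype V₁] [DecidableEq V₁] [Fintype V₂]
  {G₁ : SimpleGraph V₁} {G₂ : SimpleGraph V₂} {v₁ : V₁} {v₂ : V₂}

/-- The edges of a 1-sum are those of the two summands. -/
theorem adjSum_oneSum (F : {x : V₁ // x ≠ v₁} ⊕ V₂ → {x : V₁ // x ≠ v₁} ⊕ V₂ → ℝ) :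
    adjSum (oneSum G₁ v₁ G₂ v₂) F =
      adjSum G₁ (fun x y => F (oneSumLeft v₁ v₂ x) (oneSumLeft v₁ v₂ y)) +
      adjSum G₂ (fun x y => F (Sum.inr x) (Sum.inr y)) := by
  classical
  -- Isolating `v₁` matches the pairs of `G₁` that involve it with the mixed pairs of the 1-sum,
  -- where the second-summand vertex must be `v₂`.
  have hsplit : ∀ f : V₁ → ℝ, ∑ x, f x = f v₁ + ∑ a : {x : V₁ // x ≠ v₁}, f a := by
    intro f
    rw [← Finset.add_sum_erase _ f (Finset.mem_univ v₁)]
    congr 1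
    exact (Finset.sum_subtype _ (by simp) f)
  have hll : ∀ a b : {x : V₁ // x ≠ v₁},
      (oneSum G₁ v₁ G₂ v₂).Adj (Sum.inl a) (Sum.inl b) ↔ G₁.Adj a b := fun _ _ => Iff.rfl
  have hlr : ∀ (a : {x : V₁ // x ≠ v₁}) (w : V₂),
      (oneSum G₁ v₁ G₂ v₂).Adj (Sum.inl a) (Sum.inr w) ↔ w = v₂ ∧ G₁.Adj a v₁ :=
    fun _ _ => and_comm
  have hrl : ∀ (a : {x : V₁ // x ≠ v₁}) (w : V₂),
      (oneSum G₁ v₁ G₂ v₂).Adj (Sum.inr w) (Sum.inl a) ↔ w = v₂ ∧ G₁.Adj v₁ a :=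
    fun a w => and_comm.trans (by rw [G₁.adj_comm])
  have hrr : ∀ w w' : V₂,
      (oneSum G₁ v₁ G₂ v₂).Adj (Sum.inr w) (Sum.inr w') ↔ G₂.Adj w w' := fun _ _ => Iff.rfl
  simp only [adjSum, Fintype.sum_sum_type, hll, hlr, hrl, hrr, hsplit, oneSumLeft_self,
    oneSumLeft_coe, SimpleGraph.irrefl, if_false, ite_and, Finset.sum_ite_eq', Finset.mem_univ,
    if_true, Finset.sum_add_distrib, zero_add]
  rw [Finset.sum_comm (s := (Finset.univ : Finset V₂))]
  simp only [Finset.sum_ite_eq', Finset.mem_univ, if_true]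
  ring

theorem numEdges_oneSum :
    (numEdges (oneSum G₁ v₁ G₂ v₂) : ℝ) = numEdges G₁ + numEdges G₂ := by
  have h := adjSum_oneSum (G₁ := G₁) (G₂ := G₂) (v₁ := v₁) (v₂ := v₂) fun _ _ => 1
  simp only [adjSum_const] at h
  linarith

/-- A potential on `G₁`, extended by a constant over `G₂`, carries no current there and remains a
unit-flow potential. -/
theorem effectiveResistance_oneSum_left (h₁ : G₁.Connected) (i j : V₁) :
    effectiveResistance (oneSum G₁ v₁ G₂ v₂) (oneSumLeft v₁ v₂ i) (oneSumLeft v₁ v₂ j) =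
      effectiveResistance G₁ i j := by
  obtain ⟨φ, hφ, hr⟩ := exists_potential h₁ i j
  obtain ⟨Φ, hl, hc⟩ := exists_extend_left (v₁ := v₁) v₂ φ
  rw [hr, ← hl i, ← hl j]
  refine effectiveResistance_eq_sub _ fun ψ => ?_
  rw [adjSum_oneSum]
  simp only [hl, hc, sub_self, zero_mul, adjSum_const, mul_zero, add_zero]
  exact hφ fun x => ψ (oneSumLeft v₁ v₂ x)

theorem effectiveResistance_oneSum_right (h₂ : G₂.Connected) (i j : V₂) :
    effectiveResistance (oneSum G₁ v₁ G₂ v₂) (Sum.inr i) (Sum.inr j) =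
      effectiveResistance G₂ i j := by
  obtain ⟨φ, hφ, hr⟩ := exists_potential h₂ i j
  obtain ⟨Φ, hl, hc⟩ := exists_extend_right v₁ v₂ φ
  rw [hr, ← hc i, ← hc j]
  refine effectiveResistance_eq_sub _ fun ψ => ?_
  rw [adjSum_oneSum]
  simp only [hl, hc, sub_self, zero_mul, adjSum_const, mul_zero, zero_add]
  exact hφ fun x => ψ (Sum.inr x)

/-- Effective resistances add up across the cut vertex of a 1-sum. -/
theorem effectiveResistance_oneSum_left_right (h₁ : G₁.Connected) (h₂ : G₂.Connected)
    (i : V₁) (j : V₂) :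
    effectiveResistance (oneSum G₁ v₁ G₂ v₂) (oneSumLeft v₁ v₂ i) (Sum.inr j) =
      effectiveResistance G₁ i v₁ + effectiveResistance G₂ j v₂ := by
  obtain ⟨φ₁, hφ₁, hr₁⟩ := exists_potential h₁ i v₁
  obtain ⟨φ₂, hφ₂, hr₂⟩ := exists_potential h₂ v₂ j
  obtain ⟨Φ₁, hl₁, hc₁⟩ := exists_extend_left (v₁ := v₁) v₂ φ₁
  obtain ⟨Φ₂, hl₂, hc₂⟩ := exists_extend_right v₁ v₂ φ₂
  -- Superposition of unit flows from `i` to the cut vertex and from there to `j`: the contributions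
  -- of `ψ` at the cut vertex cancel.
  have h := effectiveResistance_eq_sub (oneSum G₁ v₁ G₂ v₂) (i := oneSumLeft v₁ v₂ i)
    (j := Sum.inr j) (φ := fun x => Φ₁ x + Φ₂ x) fun ψ => by
      rw [adjSum_oneSum]
      simp only [hl₁, hc₁, hl₂, hc₂, add_sub_add_left_eq_sub, add_sub_add_right_eq_sub]
      rw [hφ₁ fun x => ψ (oneSumLeft v₁ v₂ x), hφ₂ fun x => ψ (Sum.inr x), oneSumLeft_self]
      ring
  rw [h, hr₁, effectiveResistance_comm G₂, hr₂]
  simp only [hl₁, hc₁, hl₂, hc₂]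
  ring

theorem moment_eq_adjSum {V : Type*} [Fintype V] (G : SimpleGraph V) (v : V) :
    moment G v = adjSum G fun x _ => effectiveResistance G x v :=
  sum_deg_mul G _

/-- Kemeny's constant of a 1-sum. -/
theorem numEdges_mul_kemeny_oneSum (h₁ : G₁.Connected) (h₂ : G₂.Connected)
    (s : {x : V₁ // x ≠ v₁} ⊕ V₂) (s₁ : V₁) (s₂ : V₂) :
    numEdges (oneSum G₁ v₁ G₂ v₂) * kemeny (oneSum G₁ v₁ G₂ v₂) s =
      numEdges G₁ * kemeny G₁ s₁ + numEdges G₂ * kemeny G₂ s₂ +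
      numEdges G₂ * moment G₁ v₁ + numEdges G₁ * moment G₂ v₂ := by
  have h := four_mul_numEdges_mul_kemeny (oneSum_connected (v₁ := v₁) (v₂ := v₂) h₁ h₂) s
  have hr : ∀ (i : V₁) (j : V₂),
      effectiveResistance (oneSum G₁ v₁ G₂ v₂) (Sum.inr j) (oneSumLeft v₁ v₂ i) =
      effectiveResistance G₁ i v₁ + effectiveResistance G₂ j v₂ := fun i j => by
    rw [effectiveResistance_comm, effectiveResistance_oneSum_left_right h₁ h₂]
  -- The diagonal blocks give `4 m₁ 𝒦(G₁)` and `4 m₂ 𝒦(G₂)`; each of the two mixed blocks gives `2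
  -- m₂ μ(G₁,v) + 2 m₁ μ(G₂,v)`.
  simp only [adjSum_oneSum, effectiveResistance_oneSum_left h₁,
    effectiveResistance_oneSum_right h₂, effectiveResistance_oneSum_left_right h₁ h₂, hr,
    adjSum_add, adjSum_const, adjSum_const_mul, ← four_mul_numEdges_mul_kemeny h₁ s₁,
    ← four_mul_numEdges_mul_kemeny h₂ s₂, ← moment_eq_adjSum] at h
  linarith

end OneSum

end KemenyGraph

/-! ### Comparison of the two 1-sums -/

theorem mainTheorem5 {V₁ V₂ : Type*} [Fintype V₁] [DecidableEq V₁] [Fintype V₂]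
    (G₁ : SimpleGraph V₁) (G₂ : SimpleGraph V₂) (hG₁ : G₁.Connected) (hG₂ : G₂.Connected)
    (v₁ : V₁) (v₂ : V₂)
    -- a set of non-edges of `G₂`
    (L : Finset (Sym2 V₂)) (hL : ∀ e ∈ L, ¬ e.IsDiag ∧ e ∉ G₂.edgeSet)
    (G Ghat : SimpleGraph ({x : V₁ // x ≠ v₁} ⊕ V₂)) (G₂hat : SimpleGraph V₂)
    (hG : G = KemenyGraph.oneSum G₁ v₁ G₂ v₂)
    (hGhat : Ghat = KemenyGraph.addEdges G (Sym2.map Sum.inr '' (L : Set (Sym2 V₂))))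
    (hG₂hat : G₂hat = KemenyGraph.addEdges G₂ (L : Set (Sym2 V₂)))
    (m₁ m₂ m l : ℝ) (hm₁ : m₁ = KemenyGraph.numEdges G₁) (hm₂ : m₂ = KemenyGraph.numEdges G₂)
    (hm : m = KemenyGraph.numEdges G) (hl : l = L.card) (hpos : 0 < m)
    -- arbitrary starting vertices for the Kemeny constants, which do not depend on them
    (s shat : {x : V₁ // x ≠ v₁} ⊕ V₂) (s₁ : V₁) (s₂ s₂hat : V₂)
    (A B C : ℝ)
    (hA : A = KemenyGraph.moment G₂hat v₂ - KemenyGraph.moment G₂ v₂)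
    (hB : B = KemenyGraph.kemeny G₂hat s₂hat - KemenyGraph.moment G₂ v₂)
    (hC : C = KemenyGraph.kemeny G₂hat s₂hat - KemenyGraph.kemeny G₂ s₂) :
    m = m₁ + m₂ ∧ (KemenyGraph.numEdges Ghat : ℝ) = m + l ∧
    KemenyGraph.kemeny Ghat shat - KemenyGraph.kemeny G s =
      l * m₁ * (KemenyGraph.moment G₁ v₁ - KemenyGraph.kemeny G₁ s₁) / (m * (m + l)) +
      (A * m₁ ^ 2 + ((A + C) * m₂ + B * l) * m₁ + C * (m₂ ^ 2 + l * m₂)) / (m * (m + l)) := by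
  subst hG
  rw [KemenyGraph.addEdges_oneSum, ← hG₂hat] at hGhat
  subst hGhat
  have hc₂ : G₂hat.Connected := hG₂hat ▸ KemenyGraph.addEdges_connected hG₂ _
  have hm₂hat : (KemenyGraph.numEdges G₂hat : ℝ) = m₂ + l := by
    rw [hG₂hat, KemenyGraph.numEdges_addEdges G₂ L hL, hm₂, hl, Nat.cast_add]
  have hsum : m = m₁ + m₂ := by rw [hm, hm₁, hm₂, KemenyGraph.numEdges_oneSum]
  have hsumhat : (KemenyGraph.numEdges (KemenyGraph.oneSum G₁ v₁ G₂hat v₂) : ℝ) = m + l := by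
    rw [KemenyGraph.numEdges_oneSum, hm₂hat, ← hm₁, hsum]
    ring
  refine ⟨hsum, hsumhat, ?_⟩
  have hl0 : 0 ≤ l := hl ▸ Nat.cast_nonneg _
  have hK := KemenyGraph.numEdges_mul_kemeny_oneSum (v₁ := v₁) (v₂ := v₂) hG₁ hG₂ s s₁ s₂
  have hKhat :=
    KemenyGraph.numEdges_mul_kemeny_oneSum (v₁ := v₁) (v₂ := v₂) hG₁ hc₂ shat s₁ s₂hat
  rw [← hm, ← hm₁, ← hm₂] at hK
  rw [hsumhat, hm₂hat, ← hm₁] at hKhat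
  have hml : m + l ≠ 0 := by positivity
  have hm0 : m ≠ 0 := hpos.ne'
  rw [mul_comm, ← eq_div_iff hm0] at hK
  rw [mul_comm, ← eq_div_iff hml] at hKhat
  -- Over the denominator `m (m + l)` this is a polynomial identity once `m = m₁ + m₂`. For
  -- instance, `μ(G₁,v)` has coefficient `(m₂ + l) m - m₂ (m + l) = l m₁`.
  rw [hK, hKhat, hA, hB, hC, div_sub_div _ _ hml hm0, ← add_div, mul_comm (m + l) m, hsum]
  congr 1
  ring
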